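/- Let $\mathcal V$ be a Euclidean Jordan algebra, i.e. a finite-dimensional real inner product space with a bilinear commutative product $\circ$ that has a unit element $e$ and satisfies $x\circ(x^2\circ y)=x^2\circ(x\circ y)$ and $\langle x\circ y,z\rangle=\langle x,y\circ z\rangle$, where $x^2=x\circ x$. A primitive idempotent is a nonzero $c$ with $c^2=c$ that is not a sum of two nonzero idempotents; a Jordan frame is a finite family of primitive idempotents with pairwise products $0$ and sum $e$. Every $x\in\mathcal V$ can be written $x=\sum_i\lambda_i f_i$ for some Jordan frame $(f_i)$, and $\mathrm{trace}(x):=\sum_i\lambda_i$ is independent of the choice; assume that $\mathcal V$ carries the inner product $\langle x,y\rangle=\mathrm{trace}(x\circ y)$. Let $\mathcal V_+=\{x\circ x: x\in\mathcal V\}$. For a linear $L:\mathcal V\to\mathcal V$ and $p\in\mathcal V$, let $\mathrm{SOL}(L,\mathcal V_+,p)$ be the set of $x\in\mathcal V_+$ with $L(x)+p\in\mathcal V_+$ and $\langle x,L(x)+p\rangle=0$. We call $L$ copositive on $\mathcal V_+$ if $\langle L(x),x\rangle\ge0$ for all $x\in\mathcal V_+$, and strictly copositive if $\langle L(x),x\rangle>0$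 for all $0\ne x\in\mathcal V_+$. We write $L\in\mathbf R_0(\mathcal V)$ if $\mathrm{SOL}(L,\mathcal V_+,0)=\{0\}$; $L\in\mathbf R(\mathcal V)$ if $\mathrm{SOL}(L,\mathcal V_+,0)=\mathrm{SOL}(L,\mathcal V_+,d)=\{0\}$ for some $d$ in the interior of $\mathcal V_+$; and $L\in\mathbf Q(\mathcal V)$ if $\mathrm{SOL}(L,\mathcal V_+,p)\neq\emptyset$ for all $p\in\mathcal V$. For $A\in\mathbb R^{n\times n}$ and $q\in\mathbb R^n$, let $\mathrm{SOL}(A,q)$ be the set of $r\ge0$ in $\mathbb R^n$ with $Ar+q\ge0$ and $r^T(Ar+q)=0$; copositivity, strict copositivity on $\mathbb R^n_+$ and the classes $\mathbf R_0,\mathbf R,\mathbf Q$ of matrices are defined in the same way, with $\mathbb R^n_+$ in place of $\mathcal V_+$ (so in the definition of $\mathbf R$ the vector $d$ has all entries positive). Fix a Jordan frame $(e_1,\dots,e_n)$ of $\mathcal V$ and $A=[a_{ij}]\in\mathbb R^{n\times n}$. Put $\widehat A(x)=\sum_{i=1}^n\big(\sum_{j=1}^n a_{ij}\langle e_j,x\rangle\big)e_i$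 and $[x]=(\langle x,e_1\rangle,\dots,\langle x,e_n\rangle)^T$ for $x\in\mathcal V$, and $\widehat r=\sum_{i=1}^n r_ie_i$ for $r\in\mathbb R^n$. Then: 1. For all $q,r\in\mathbb R^n$: if $r\in\mathrm{SOL}(A,q)$, then $\widehat r\in\mathrm{SOL}(\widehat A,\mathcal V_+,\widehat q)$. 2. For all $q\in\mathbb R^n$ and $x\in\mathcal V$: if $x\in\mathrm{SOL}(\widehat A,\mathcal V_+,\widehat q)$, then $[x]\in\mathrm{SOL}(A,q)$. 3. $A$ is copositive on $\mathbb R^n_+$ if and only if $\widehat A$ is copositive on $\mathcal V_+$; and $A$ is strictly copositive on $\mathbb R^n_+$ if and only if $\widehat A$ is strictly copositive on $\mathcal V_+$. 4. $A\in\mathbf R_0$ if and only if $\widehat A\in\mathbf R_0(\mathcal V)$. 5. If $A\in\mathbf R$, then $\widehat A\in\mathbf R(\mathcal V)$. 6. If $\widehat A\in\mathbf Q(\mathcal V)$, then $A\in\mathbf Q$. -/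

import Mathlib

open scoped Matrix

noncomputable section

/-- A Euclidean Jordan algebra: a finite-dimensional real inner product space with a commutative
bilinear product `mul` that satisfies the Jordan identity, is compatible with the inner product,
and has a unit element `one`. -/
structure EuclideanJordanAlgebra (V : Type*) [NormedAddCommGroup V] [InnerProductSpace ℝ V]
    [FiniteDimensional ℝ V] where
  mul : V →ₗ[ℝ] V →ₗ[ℝ] V
  mul_comm : ∀ x y, mul x y = mul y x
  jordan : ∀ x y, mul x (mul (mul x x) y) = mul (mul x x) (mul x y)
  inner_mul : ∀ x y z, inner ℝ (mul x y) z = inner ℝ x (mul y z)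
  one : V
  mul_one : ∀ x, mul x one = x

namespace EuclideanJordanAlgebra

variable {V : Type*} [NormedAddCommGroup V] [InnerProductSpace ℝ V] [FiniteDimensional ℝ V]

/-- A nonzero element `c` with `c ∘ c = c`. -/
def IsIdempotent (J : EuclideanJordanAlgebra V) (c : V) : Prop :=
  c ≠ 0 ∧ J.mul c c = c

/-- An idempotent that is not the sum of two (nonzero) idempotents. -/
def IsPrimitive (J : EuclideanJordanAlgebra V) (c : V) : Prop :=
  J.IsIdempotent c ∧ ¬ ∃ a b, J.IsIdempotent a ∧ J.IsIdempotent b ∧ c = a + b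

/-- A Jordan frame: mutually orthogonal primitive idempotents whose sum is the unit. -/
structure IsJordanFrame (J : EuclideanJordanAlgebra V) {n : ℕ} (e : Fin n → V) : Prop where
  primitive : ∀ i, J.IsPrimitive (e i)
  orthogonal : ∀ i j, i ≠ j → J.mul (e i) (e j) = 0
  sum_eq_one : ∑ i, e i = J.one

/-- `t` is the sum of the coefficients `l i` in a spectral decomposition `x = ∑ i, l i • f i`
with respect to some Jordan frame `f`. -/
def IsEigenvalueSum (J : EuclideanJordanAlgebra V) (x : V) (t : ℝ) : Prop :=
  ∃ (k : ℕ) (f : Fin k → V) (l : Fin k → ℝ),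
    J.IsJordanFrame f ∧ x = ∑ i, l i • f i ∧ t = ∑ i, l i

open Classical in
/-- The trace of `x`: the sum of its eigenvalues (every element has a spectral decomposition, and
the eigenvalues do not depend on it, so the default value is never used). -/
def trace (J : EuclideanJordanAlgebra V) (x : V) : ℝ :=
  if h : ∃ t, J.IsEigenvalueSum x t then h.choose else 0

/-- The inner product of the space is the trace inner product `⟪x, y⟫ = trace (x ∘ y)`. -/
def HasTraceInner (J : EuclideanJordanAlgebra V) : Prop :=
  ∀ x y : V, inner ℝ x y = J.trace (J.mul x y)

/-- The symmetric cone `V₊`, the set of all squares. -/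
def cone (J : EuclideanJordanAlgebra V) : Set V :=
  {x | ∃ z, x = J.mul z z}

/-- The solution set of the symmetric cone problem `LCP(L, V₊, p)`. -/
def solLCP (J : EuclideanJordanAlgebra V) (L : V →ₗ[ℝ] V) (p : V) : Set V :=
  {x | x ∈ J.cone ∧ L x + p ∈ J.cone ∧ inner ℝ x (L x + p) = 0}

/-- `L` is copositive on `V₊`. -/
def IsCopositive (J : EuclideanJordanAlgebra V) (L : V →ₗ[ℝ] V) : Prop :=
  ∀ x ∈ J.cone, 0 ≤ inner ℝ (L x) x

/-- `L` is strictly copositive on `V₊`. -/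
def IsStrictlyCopositive (J : EuclideanJordanAlgebra V) (L : V →ₗ[ℝ] V) : Prop :=
  ∀ x ∈ J.cone, x ≠ 0 → 0 < inner ℝ (L x) x

/-- The class `R₀(V)`. -/
def IsR0 (J : EuclideanJordanAlgebra V) (L : V →ₗ[ℝ] V) : Prop :=
  J.solLCP L 0 = {0}

/-- The class `R(V)`: `LCP(L, V₊, 0)` and `LCP(L, V₊, d)` have only the zero solution, for some
`d` in the interior of `V₊`. -/
def IsR (J : EuclideanJordanAlgebra V) (L : V →ₗ[ℝ] V) : Prop :=
  ∃ d ∈ interior J.cone, J.solLCP L 0 = {0} ∧ J.solLCP L d = {0}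

/-- The class `Q(V)`. -/
def IsQ (J : EuclideanJordanAlgebra V) (L : V →ₗ[ℝ] V) : Prop :=
  ∀ p : V, (J.solLCP L p).Nonempty

end EuclideanJordanAlgebra

namespace MatrixLCP

variable {n : ℕ}

/-- The solution set of the linear complementarity problem `LCP(A, q)` on `ℝⁿ`. -/
def sol (A : Matrix (Fin n) (Fin n) ℝ) (q : Fin n → ℝ) : Set (Fin n → ℝ) :=
  {r | 0 ≤ r ∧ 0 ≤ A *ᵥ r + q ∧ r ⬝ᵥ (A *ᵥ r + q) = 0}

/-- `A` is copositive on the nonnegative orthant. -/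
def IsCopositive (A : Matrix (Fin n) (Fin n) ℝ) : Prop :=
  ∀ r : Fin n → ℝ, 0 ≤ r → 0 ≤ (A *ᵥ r) ⬝ᵥ r

/-- `A` is strictly copositive on the nonnegative orthant. -/
def IsStrictlyCopositive (A : Matrix (Fin n) (Fin n) ℝ) : Prop :=
  ∀ r : Fin n → ℝ, 0 ≤ r → r ≠ 0 → 0 < (A *ᵥ r) ⬝ᵥ r

/-- The class `R₀`. -/
def IsR0 (A : Matrix (Fin n) (Fin n) ℝ) : Prop :=
  sol A 0 = {0}

/-- The class `R`: `LCP(A, 0)` and `LCP(A, d)` have only the zero solution, for some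
(entrywise) positive vector `d`. -/
def IsR (A : Matrix (Fin n) (Fin n) ℝ) : Prop :=
  ∃ d : Fin n → ℝ, (∀ i, 0 < d i) ∧ sol A 0 = {0} ∧ sol A d = {0}

/-- The class `Q`. -/
def IsQ (A : Matrix (Fin n) (Fin n) ℝ) : Prop :=
  ∀ q : Fin n → ℝ, (sol A q).Nonempty

end MatrixLCP

section Embedding

variable {V : Type*} [NormedAddCommGroup V] [InnerProductSpace ℝ V] {n : ℕ}

/-- The transformation `Â = ∑ i j, a i j • (e i ⊗ e j)`, where `a ⊗ b` is the rank-one map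
`x ↦ ⟪b, x⟫ • a`. -/
def hatMap (e : Fin n → V) (A : Matrix (Fin n) (Fin n) ℝ) : V →ₗ[ℝ] V :=
  ∑ i, ∑ j, A i j • (InnerProductSpace.rankOne ℝ (e i) (e j) : V →L[ℝ] V).toLinearMap

/-- The element `r̂ = ∑ i, r i • e i`. -/
def hatVec (e : Fin n → V) (r : Fin n → ℝ) : V :=
  ∑ i, r i • e i

/-- The vector `[x] = (⟪x, e 1⟫, …, ⟪x, e n⟫)`. -/
def bracket (e : Fin n → V) (x : V) : Fin n → ℝ :=
  fun i => inner ℝ x (e i)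

end Embedding

end

open scoped Matrix

namespace EuclideanJordanAlgebra

variable {V : Type*} [NormedAddCommGroup V] [InnerProductSpace ℝ V] [FiniteDimensional ℝ V]
  {J : EuclideanJordanAlgebra V} {n : ℕ} {e : Fin n → V}

/-! The map `hatMap e A` factors as `hatVec e` ∘ `A` ∘ `bracket e` (`hatMap_apply`), and `bracket e`
is adjoint to `hatVec e` (`inner_hatVec`) and a left inverse of it (`bracket_hatVec`, which needs
the frame orthonormal, hence the trace inner product). Both maps respect the cones and send no
nonzero element of them to 0, so solutions and quadratic forms transfer in both directions. The
Jordan-algebraic input is that multiplication by an idempotent is positive semidefinite, which gives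
`bracket_nonneg`. The class R also needs positive vectors to land in the interior of the cone, which
follows from openness of squaring. -/

/-- The linearized Jordan identity. -/
lemma jordan_linearized (J : EuclideanJordanAlgebra V) (x y z : V) :
    J.mul y (J.mul (J.mul x x) z) + (2 : ℝ) • J.mul x (J.mul (J.mul x y) z) =
      J.mul (J.mul x x) (J.mul y z) + (2 : ℝ) • J.mul (J.mul x y) (J.mul x z) := by
  -- Polarization: the identity is cubic in its first variable. The difference of `h₁` and `h₂`
  -- keeps the parts odd in `y`, and `h₃` removes the cubic one.
  have h₁ := J.jordan (x + y) z
  have h₂ := J.jordan (x - y) z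
  have h₃ := J.jordan y z
  simp only [map_add, map_sub, LinearMap.add_apply, LinearMap.sub_apply, J.mul_comm y x] at h₁ h₂
  have h : (2 : ℝ) • (J.mul y (J.mul (J.mul x x) z) + (2 : ℝ) • J.mul x (J.mul (J.mul x y) z)) =
      (2 : ℝ) • (J.mul (J.mul x x) (J.mul y z) +
        (2 : ℝ) • J.mul (J.mul x y) (J.mul x z)) := by
    linear_combination (norm := module) h₁ - h₂ - (2 : ℝ) • h₃
  exact smul_right_injective V (two_ne_zero' ℝ) h

/-- Multiplication by an idempotent is annihilated by `2t³ - 3t² + t`. -/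
lemma mul_idempotent_cubic (J : EuclideanJordanAlgebra V) {c : V} (hc : J.mul c c = c) (z : V) :
    (2 : ℝ) • J.mul c (J.mul c (J.mul c z)) = (3 : ℝ) • J.mul c (J.mul c z) - J.mul c z := by
  have h := J.jordan_linearized c z c
  rw [hc, hc, J.mul_comm (J.mul c z) c, J.mul_comm z c] at h
  linear_combination (norm := module) h

/-- Multiplication by an idempotent is positive semidefinite. -/
lemma inner_mul_idempotent_nonneg (J : EuclideanJordanAlgebra V) {c : V} (hc : J.mul c c = c)
    (z : V) : 0 ≤ (inner ℝ (J.mul c z) z : ℝ) := by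
  have sym : ∀ x y : V, (inner ℝ (J.mul c x) y : ℝ) = inner ℝ x (J.mul c y) := fun x y => by
    rw [J.mul_comm, J.inner_mul]
  have h₃ := J.mul_idempotent_cubic hc z
  set u := J.mul c z with hu
  set v := J.mul c u with hv
  set w := J.mul c v with hw
  have hw' : w = (3 / 2 : ℝ) • v - (1 / 2 : ℝ) • u := by
    have : w = (1 / 2 : ℝ) • (2 : ℝ) • w := by rw [smul_smul]; norm_num
    rw [this, h₃]; module
  have a₁ : (inner ℝ v z : ℝ) = inner ℝ u u := sym u z
  have a₂ : (inner ℝ w z : ℝ) = inner ℝ v u := sym v z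
  have a₃ : (inner ℝ w u : ℝ) = inner ℝ v v := sym v u
  rw [hw', inner_sub_left, inner_smul_left, inner_smul_left] at a₂ a₃
  -- With T self-adjoint and its eigenvalues among 0, 1/2, 1, one has T = (2T² - T)² + 8(T - T²)²;
  -- these are the two squares.
  have p₁ : (0 : ℝ) ≤ inner ℝ ((2 : ℝ) • v - u) ((2 : ℝ) • v - u) := real_inner_self_nonneg
  have p₂ : (0 : ℝ) ≤ inner ℝ (u - v) (u - v) := real_inner_self_nonneg
  simp only [inner_sub_left, inner_sub_right, inner_smul_left, inner_smul_right,
    real_inner_comm u v, conj_trivial] at p₁ p₂ a₂ a₃ a₁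
  have hs : (inner ℝ u v : ℝ) = inner ℝ v u := real_inner_comm _ _
  simp only [hs] at p₁ p₂ a₂ a₃ a₁
  nlinarith

lemma inner_idempotent_nonneg_of_mem_cone (J : EuclideanJordanAlgebra V) {c x : V}
    (hc : J.mul c c = c) (hx : x ∈ J.cone) : 0 ≤ (inner ℝ x c : ℝ) := by
  obtain ⟨z, rfl⟩ := hx
  rw [J.inner_mul, J.mul_comm z c, real_inner_comm]
  exact J.inner_mul_idempotent_nonneg hc z

namespace IsJordanFrame

lemma idem (he : J.IsJordanFrame e) (i : Fin n) : J.mul (e i) (e i) = e i :=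
  (he.primitive i).1.2

lemma ne_zero (he : J.IsJordanFrame e) (i : Fin n) : e i ≠ 0 :=
  (he.primitive i).1.1

lemma mul_hatVec (he : J.IsJordanFrame e) (r s : Fin n → ℝ) :
    J.mul (hatVec e r) (hatVec e s) = hatVec e (r * s) := by
  simp only [hatVec, map_sum, LinearMap.sum_apply, map_smul, LinearMap.smul_apply]
  refine Finset.sum_congr rfl fun i _ => ?_
  rw [Finset.sum_eq_single i, he.idem, smul_smul, Pi.mul_apply, _root_.mul_comm]
  · intro j _ hj
    rw [he.orthogonal j i hj, smul_zero]
  · simp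

lemma inner_eq_zero (he : J.IsJordanFrame e) {i j : Fin n} (hij : i ≠ j) :
    (inner ℝ (e i) (e j) : ℝ) = 0 := by
  rw [← he.idem i, J.inner_mul, he.orthogonal i j hij, inner_zero_right]

lemma linearIndependent (he : J.IsJordanFrame e) : LinearIndependent ℝ e :=
  linearIndependent_of_ne_zero_of_inner_eq_zero he.ne_zero fun _ _ hij => he.inner_eq_zero hij

lemma hatVec_injective (he : J.IsJordanFrame e) : Function.Injective (hatVec e) :=
  fun r s h => by
    have := Fintype.linearIndependent_iff.mp he.linearIndependent (r - s) <| by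
      simpa [hatVec, sub_smul, sub_eq_zero] using h
    exact funext fun i => sub_eq_zero.mp (this i)

lemma hatVec_eq_zero (he : J.IsJordanFrame e) {r : Fin n → ℝ} (h : hatVec e r = 0) : r = 0 :=
  he.hatVec_injective (h.trans (by simp [hatVec]))

end IsJordanFrame

/-- Every eigenvalue sum of a primitive idempotent equals one. -/
lemma IsPrimitive.eigenvalueSum_eq_one {c : V} (hc : J.IsPrimitive c) {t : ℝ}
    (ht : J.IsEigenvalueSum c t) : t = 1 := by
  obtain ⟨k, f, l, hf, hcl, rfl⟩ := ht
  change c = hatVec f l at hcl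
  have hl : l * l = l := hf.hatVec_injective <| by
    rw [← hf.mul_hatVec, ← hcl, hc.1.2]
  have hl01 (i) : l i = 0 ∨ l i = 1 := by
    have := congrFun hl i
    exact IsIdempotentElem.iff_eq_zero_or_one.mp this
  obtain ⟨i, hi⟩ : ∃ i, l i ≠ 0 := by
    by_contra! h
    exact hc.1.1 (by simp [hcl, hatVec, h])
  have hi1 : l i = 1 := (hl01 i).resolve_left hi
  -- The coefficients are 0 or 1, so removing `f i` leaves an idempotent or zero; primitivity forces
  -- zero.
  have hsplit : c = f i + (c - f i) := by abel
  have hfi : f i = hatVec f (Pi.single i 1) := by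
    simp [hatVec, Pi.single_apply]
  have hsub : c - f i = hatVec f (l - Pi.single i 1) := by
    rw [hcl, hfi]
    simp only [hatVec, Pi.sub_apply, sub_smul, Finset.sum_sub_distrib]
  have hidem : (l - Pi.single i 1) * (l - Pi.single i 1) = l - Pi.single i (1 : ℝ) := by
    ext j
    rcases eq_or_ne j i with rfl | hj
    · simp [hi1]
    · rcases hl01 j with h | h <;> simp [hj, h]
  have hzero : c - f i = 0 := by
    by_contra hne
    exact hc.2 ⟨f i, c - f i, (hf.primitive i).1,
      ⟨hne, by rw [hsub, hf.mul_hatVec, hidem]⟩, hsplit⟩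
  have := sub_eq_zero.mp (hf.hatVec_eq_zero (hsub.symm.trans hzero))
  simp [this]

/-! ### Orthonormality of the frame and its relation to the cone -/

namespace IsJordanFrame

/-- `trace` selects some eigenvalue sum; independence of the choice is needed only for primitive
idempotents, where every such sum is 1. -/
lemma inner_self (hJ : J.HasTraceInner) (he : J.IsJordanFrame e) (i : Fin n) :
    (inner ℝ (e i) (e i) : ℝ) = 1 := by
  have h : ∃ t, J.IsEigenvalueSum (e i) t :=
    ⟨_, n, e, Pi.single i 1, he, by simp [Pi.single_apply], rfl⟩
  rw [hJ, he.idem, trace, dif_pos h]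
  exact (he.primitive i).eigenvalueSum_eq_one h.choose_spec

lemma bracket_hatVec (hJ : J.HasTraceInner) (he : J.IsJordanFrame e) (r : Fin n → ℝ) :
    bracket e (hatVec e r) = r := by
  ext i
  simp only [bracket, hatVec, sum_inner, inner_smul_left, conj_trivial]
  rw [Finset.sum_eq_single i, he.inner_self hJ, _root_.mul_one]
  · intro j _ hj
    rw [he.inner_eq_zero hj, mul_zero]
  · simp

lemma hatVec_mem_cone (he : J.IsJordanFrame e) {r : Fin n → ℝ} (hr : 0 ≤ r) :
    hatVec e r ∈ J.cone := by
  refine ⟨hatVec e fun i => √(r i), ?_⟩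
  rw [he.mul_hatVec]
  congr 1
  ext i
  exact (Real.mul_self_sqrt (hr i)).symm

lemma bracket_nonneg (he : J.IsJordanFrame e) {x : V} (hx : x ∈ J.cone) : 0 ≤ bracket e x :=
  fun i => J.inner_idempotent_nonneg_of_mem_cone (he.idem i) hx

/-- The entries of the bracket of z ∘ z add up to ⟪z ∘ z, 1⟫ = ‖z‖². -/
lemma eq_zero_of_bracket_eq_zero (he : J.IsJordanFrame e) {x : V} (hx : x ∈ J.cone)
    (h : bracket e x = 0) : x = 0 := by
  obtain ⟨z, rfl⟩ := hx
  have h₁ : (inner ℝ (J.mul z z) J.one : ℝ) = 0 := by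
    rw [← he.sum_eq_one, inner_sum]
    exact Finset.sum_eq_zero fun i _ => congrFun h i
  rw [J.inner_mul, J.mul_one, inner_self_eq_zero] at h₁
  simp [h₁]

/-- Multiplication by a positive combination of the frame is positive definite. -/
lemma mul_hatVec_ker (he : J.IsJordanFrame e) {s : Fin n → ℝ} (hs : ∀ i, 0 < s i) :
    LinearMap.ker (J.mul (hatVec e s)) = ⊥ := by
  refine LinearMap.ker_eq_bot'.mpr fun z hz => ?_
  have h₀ : ∑ i, s i * (inner ℝ (J.mul (e i) z) z : ℝ) = 0 := by
    have : (inner ℝ (J.mul (hatVec e s) z) z : ℝ) = 0 := by rw [hz, inner_zero_left]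
    simpa [hatVec, LinearMap.sum_apply, sum_inner, inner_smul_left] using this
  have hnn (i) : 0 ≤ (inner ℝ (J.mul (e i) z) z : ℝ) :=
    J.inner_mul_idempotent_nonneg (he.idem i) z
  rw [Finset.sum_eq_zero_iff_of_nonneg fun i _ => mul_nonneg (hs i).le (hnn i)] at h₀
  have h₁ : (inner ℝ (J.mul J.one z) z : ℝ) = 0 := by
    rw [← he.sum_eq_one, map_sum, LinearMap.sum_apply, sum_inner]
    exact Finset.sum_eq_zero fun i hi =>
      (mul_eq_zero.mp (h₀ i hi)).resolve_left (hs i).ne'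
  rwa [J.mul_comm, J.mul_one, inner_self_eq_zero] at h₁

/-- A positive combination of the frame is interior to the cone, because squaring is open near
its square root. -/
lemma hatVec_mem_interior_cone (he : J.IsJordanFrame e) {d : Fin n → ℝ} (hd : ∀ i, 0 < d i) :
    hatVec e d ∈ interior J.cone := by
  have : CompleteSpace V := FiniteDimensional.complete ℝ V
  set s : Fin n → ℝ := fun i => √(d i) with hs
  set z := hatVec e s with hz
  have hzz : J.mul z z = hatVec e d := by
    rw [hz, he.mul_hatVec]
    congr 1
    ext i
    exact Real.mul_self_sqrt (hd i).le
  let B : V →L[ℝ] V →L[ℝ] V :=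
    LinearMap.toContinuousLinearMap (LinearMap.toContinuousLinearMap.toLinearMap ∘ₗ J.mul)
  have hB (x y) : B x y = J.mul x y := rfl
  have hderiv : HasStrictFDerivAt (fun x => B x x) ((2 : ℝ) • B z) z := by
    have h := B.isBoundedBilinearMap.hasStrictFDerivAt (z, z)
    have h' := h.comp (f := fun x => (x, x)) z ((hasStrictFDerivAt_id z).prodMk (hasStrictFDerivAt_id z))
    refine h'.congr_fderiv ?_
    ext y
    simp [hB, J.mul_comm y z, two_smul]
  -- The derivative of squaring at `z` is twice multiplication by `z`, which is injective, hence
  -- surjective in finite dimension.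
  have hsurj : ((2 : ℝ) • B z).range = ⊤ := by
    have h := LinearMap.range_eq_top.mp
      (LinearMap.ker_eq_bot_iff_range_eq_top.mp
        (he.mul_hatVec_ker (s := s) fun i => Real.sqrt_pos.mpr (hd i)))
    refine LinearMap.range_eq_top.mpr fun y => ?_
    obtain ⟨x, hx⟩ := h ((1 / 2 : ℝ) • y)
    refine ⟨x, ?_⟩
    change (2 : ℝ) • J.mul z x = y
    rw [hx, smul_smul]
    norm_num
  -- Squaring thus maps the neighbourhood filter of `z` onto that of z ∘ z, and all its values lie
  -- in the cone.
  have hmap := hderiv.map_nhds_eq_of_surj hsurj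
  rw [mem_interior_iff_mem_nhds, ← hzz, ← hB, ← hmap]
  exact Filter.mem_map.mpr (Filter.univ_mem' fun x => ⟨x, rfl⟩)

end IsJordanFrame

end EuclideanJordanAlgebra

/-! ### Factorization of `hatMap` and adjointness -/

section Embedding

variable {V : Type*} [NormedAddCommGroup V] [InnerProductSpace ℝ V] {n : ℕ}

lemma hatMap_apply (e : Fin n → V) (A : Matrix (Fin n) (Fin n) ℝ) (x : V) :
    hatMap e A x = hatVec e (A *ᵥ bracket e x) := by
  simp only [hatMap, hatVec, LinearMap.sum_apply, LinearMap.smul_apply, Matrix.mulVec, dotProduct,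
    bracket, Finset.sum_smul, ContinuousLinearMap.coe_coe, InnerProductSpace.rankOne_apply,
    smul_smul, real_inner_comm]

lemma hatVec_add (e : Fin n → V) (r s : Fin n → ℝ) :
    hatVec e (r + s) = hatVec e r + hatVec e s := by
  simp [hatVec, add_smul, Finset.sum_add_distrib]

lemma hatVec_zero (e : Fin n → V) : hatVec e 0 = 0 := by
  simp [hatVec]

lemma inner_hatVec (e : Fin n → V) (x : V) (r : Fin n → ℝ) :
    (inner ℝ x (hatVec e r) : ℝ) = bracket e x ⬝ᵥ r := by
  simp [hatVec, bracket, inner_sum, inner_smul_right, dotProduct, mul_comm]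

lemma inner_hatMap_apply (e : Fin n → V) (A : Matrix (Fin n) (Fin n) ℝ) (x : V) :
    (inner ℝ (hatMap e A x) x : ℝ) = (A *ᵥ bracket e x) ⬝ᵥ bracket e x := by
  rw [hatMap_apply, real_inner_comm, inner_hatVec, dotProduct_comm]

end Embedding

/-! ### Transfer between the two complementarity problems -/

namespace EuclideanJordanAlgebra.IsJordanFrame

variable {V : Type*} [NormedAddCommGroup V] [InnerProductSpace ℝ V] [FiniteDimensional ℝ V]
  {J : EuclideanJordanAlgebra V} {n : ℕ} {e : Fin n → V}

lemma hatVec_mem_solLCP (hJ : J.HasTraceInner) (he : J.IsJordanFrame e)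
    {A : Matrix (Fin n) (Fin n) ℝ} {q r : Fin n → ℝ} (hr : r ∈ MatrixLCP.sol A q) :
    hatVec e r ∈ J.solLCP (hatMap e A) (hatVec e q) := by
  obtain ⟨h₁, h₂, h₃⟩ := hr
  have h : hatMap e A (hatVec e r) + hatVec e q = hatVec e (A *ᵥ r + q) := by
    rw [hatMap_apply, he.bracket_hatVec hJ, hatVec_add]
  refine ⟨he.hatVec_mem_cone h₁, ?_, ?_⟩
  · rw [h]
    exact he.hatVec_mem_cone h₂
  · rw [h, inner_hatVec, he.bracket_hatVec hJ, h₃]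

lemma bracket_mem_sol (hJ : J.HasTraceInner) (he : J.IsJordanFrame e)
    {A : Matrix (Fin n) (Fin n) ℝ} {q : Fin n → ℝ} {x : V}
    (hx : x ∈ J.solLCP (hatMap e A) (hatVec e q)) : bracket e x ∈ MatrixLCP.sol A q := by
  obtain ⟨h₁, h₂, h₃⟩ := hx
  rw [hatMap_apply, ← hatVec_add] at h₂ h₃
  refine ⟨he.bracket_nonneg h₁, ?_, ?_⟩
  · rw [← he.bracket_hatVec hJ (A *ᵥ bracket e x + q)]
    exact he.bracket_nonneg h₂
  · rw [← inner_hatVec, h₃]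

/-- Solutions transfer both ways, and a nonzero one stays nonzero: `hatVec e` is injective, and
`bracket e` vanishes on the cone only at 0. -/
lemma solLCP_eq_zero_iff (hJ : J.HasTraceInner) (he : J.IsJordanFrame e)
    {A : Matrix (Fin n) (Fin n) ℝ} {q : Fin n → ℝ} :
    MatrixLCP.sol A q = {0} ↔ J.solLCP (hatMap e A) (hatVec e q) = {0} := by
  simp only [Set.eq_singleton_iff_unique_mem]
  constructor
  · rintro ⟨h₀, h⟩
    exact ⟨hatVec_zero e ▸ he.hatVec_mem_solLCP hJ h₀, fun x hx =>
      he.eq_zero_of_bracket_eq_zero hx.1 (h _ (he.bracket_mem_sol hJ hx))⟩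
  · rintro ⟨h₀, h⟩
    refine ⟨?_, fun r hr => he.hatVec_eq_zero (h _ (he.hatVec_mem_solLCP hJ hr))⟩
    have := he.bracket_mem_sol hJ h₀
    rwa [← hatVec_zero e, he.bracket_hatVec hJ] at this

lemma isCopositive_iff (hJ : J.HasTraceInner) (he : J.IsJordanFrame e)
    (A : Matrix (Fin n) (Fin n) ℝ) :
    MatrixLCP.IsCopositive A ↔ J.IsCopositive (hatMap e A) := by
  constructor
  · intro h x hx
    rw [inner_hatMap_apply]
    exact h _ (he.bracket_nonneg hx)
  · intro h r hr
    have := h _ (he.hatVec_mem_cone hr)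
    rwa [inner_hatMap_apply, he.bracket_hatVec hJ] at this

lemma isStrictlyCopositive_iff (hJ : J.HasTraceInner) (he : J.IsJordanFrame e)
    (A : Matrix (Fin n) (Fin n) ℝ) :
    MatrixLCP.IsStrictlyCopositive A ↔ J.IsStrictlyCopositive (hatMap e A) := by
  constructor
  · intro h x hx hx0
    rw [inner_hatMap_apply]
    exact h _ (he.bracket_nonneg hx) fun h0 => hx0 (he.eq_zero_of_bracket_eq_zero hx h0)
  · intro h r hr hr0
    have := h _ (he.hatVec_mem_cone hr) fun h0 => hr0 (he.hatVec_eq_zero h0)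
    rwa [inner_hatMap_apply, he.bracket_hatVec hJ] at this

end EuclideanJordanAlgebra.IsJordanFrame

theorem mainTheorem11 {V : Type*} [NormedAddCommGroup V] [InnerProductSpace ℝ V]
    [FiniteDimensional ℝ V] (J : EuclideanJordanAlgebra V) (hJ : J.HasTraceInner)
    {n : ℕ} (e : Fin n → V) (he : J.IsJordanFrame e) (A : Matrix (Fin n) (Fin n) ℝ) :
    (∀ q r : Fin n → ℝ, r ∈ MatrixLCP.sol A q →
      hatVec e r ∈ J.solLCP (hatMap e A) (hatVec e q)) ∧
    (∀ (q : Fin n → ℝ) (x : V), x ∈ J.solLCP (hatMap e A) (hatVec e q) →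
      bracket e x ∈ MatrixLCP.sol A q) ∧
    (MatrixLCP.IsCopositive A ↔ J.IsCopositive (hatMap e A)) ∧
    (MatrixLCP.IsStrictlyCopositive A ↔ J.IsStrictlyCopositive (hatMap e A)) ∧
    (MatrixLCP.IsR0 A ↔ J.IsR0 (hatMap e A)) ∧
    (MatrixLCP.IsR A → J.IsR (hatMap e A)) ∧
    (J.IsQ (hatMap e A) → MatrixLCP.IsQ A) := by
  have hR0 : MatrixLCP.IsR0 A ↔ J.IsR0 (hatMap e A) := by
    rw [MatrixLCP.IsR0, EuclideanJordanAlgebra.IsR0, he.solLCP_eq_zero_iff hJ, hatVec_zero]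
  refine ⟨fun _ _ => he.hatVec_mem_solLCP hJ, fun _ _ => he.bracket_mem_sol hJ,
    he.isCopositive_iff hJ A, he.isStrictlyCopositive_iff hJ A, hR0, ?_, ?_⟩
  · rintro ⟨d, hd, h₀, h⟩
    exact ⟨hatVec e d, he.hatVec_mem_interior_cone hd, hR0.mp h₀,
      (he.solLCP_eq_zero_iff hJ).mp h⟩
  -- Solvability is used only for right-hand sides in the span of the frame.
  · intro h q
    obtain ⟨x, hx⟩ := h (hatVec e q)
    exact ⟨_, he.bracket_mem_sol hJ hx⟩
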